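/- **Setup.** In an index coding problem with $n$ messages $x_j\in\{0,1\}^{t_j}$, $j\in[n]$, receiver $j$ wants $x_j$ and knows the messages $x_i$, $i\in A_j$, where $A_j\subseteq[n]\setminus\{j\}$; its side information graph has an edge $i\to j$ whenever $i\in A_j$, and the problem is written as the list of the symbols $(j\,|\,A_j)$. For each nonempty $J\subseteq[n]$ there is a server holding the messages $x_j$, $j\in J$, which sends all receivers a word $y_J\in\{0,1\}^{u_J}$ that is a function of these messages. Receiver $j$ must recover $x_j$ exactly from all the $y_J$ and the messages $x_i$, $i\in A_j$. A tuple of rates $R_j\ge 0$ is achievable with link capacities $(C_J)$ if there are such a code and an $r>0$ with $R_j\le t_j/r$ for all $j$ and $C_J\ge u_J/r$ for all $J$. The capacity region is the closure of the set of achievable rate tuples. The problem is *centralized* if $C_{[n]}=1$ and $C_J=0$ for $J\ne[n]$. **Statement.** Let $n=3$ and $C_J=1$ for every nonempty $J\subseteq[3]$. 1. The maximum of $R_1+R_2+R_3$ over the capacity region is $9$ for the problem $(1);(2|3);(3|2)$ and $10$ for the problem $(1|3);(2|3);(3|2)$. In particular, the two capacity regions are different. 2. In the side information graph of $(1|3);(2|3);(3|2)$,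 the edge $3\to1$ lies on no directed cycle, and removing it gives the side information graph of $(1);(2|3);(3|2)$. So removing an edge that lies on no directed cycle can change the capacity region of a distributed index coding problem. 3. In contrast, for every $n$ and every centralized index coding problem with $n$ messages, removing an edge of the side information graph that lies on no directed cycle does not change the capacity region. -/

import Mathlib

/-!
Distributed index coding.  Messages and receivers are indexed by `Fin n`, so the message called
`k` in the usual 1-based notation is the element `k - 1` of `Fin n`.
-/

namespace IndexCoding

/-- An index coding problem with `n` messages: receiver `j` wants message `j` and knows the
messages in `side j`, a set that does not contain `j`. -/
@[ext]
structure Problem (n : ℕ) where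
  side : Fin n → Finset (Fin n)
  not_mem_side : ∀ j, j ∉ side j

/-- The index set of the `2 ^ n - 1` servers: the nonempty sets of messages. Server `J` holds
exactly the messages in `J`. -/
abbrev Server (n : ℕ) : Type := {J : Finset (Fin n) // J.Nonempty}

/-- Binary words of length `t`. -/
abbrev Word (t : ℕ) : Type := Fin t → Bool

/-- The side information graph: there is an edge `i → j` if receiver `j` knows message `i`. -/
def Problem.graph {n : ℕ} (P : Problem n) : Digraph (Fin n) where
  Adj i j := i ∈ P.side j

/-- The problem whose side information graph is obtained by deleting the edge `i → j`. -/
def Problem.removeEdge {n : ℕ} (P : Problem n) (i j : Fin n) : Problem n where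
  side k := if k = j then (P.side k).erase i else P.side k
  not_mem_side k h := by
    split_ifs at h
    · exact P.not_mem_side k (Finset.mem_of_mem_erase h)
    · exact P.not_mem_side k h

/-- The edge `i → j` lies on a directed cycle of `G`: there are `k ≥ 1` distinct vertices
`p 0, …, p (k - 1)` with edges `p 0 → p 1 → ⋯ → p (k - 1) → p k = p 0`, one of which is
`i → j`. -/
def OnDirectedCycle {V : Type*} (G : Digraph V) (i j : V) : Prop :=
  ∃ (k : ℕ) (p : ℕ → V), 0 < k ∧ Set.InjOn p (Set.Iio k) ∧ p k = p 0 ∧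
    (∀ m < k, G.Adj (p m) (p (m + 1))) ∧ ∃ m < k, p m = i ∧ p (m + 1) = j

/-- An index code with message lengths `t j` and server output lengths `u J`. The output of
server `J` is a function of the messages in `J`; receiver `j` decodes from the outputs of all
servers and its side information, and recovers message `j` exactly. -/
structure Code {n : ℕ} (P : Problem n) (t : Fin n → ℕ) (u : Server n → ℕ) where
  enc : ∀ J : Server n, (∀ i : {i // i ∈ J.1}, Word (t i)) → Word (u J)
  dec : ∀ j : Fin n, (∀ J : Server n, Word (u J)) →
    (∀ i : {i // i ∈ P.side j}, Word (t i)) → Word (t j)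
  exact_recovery : ∀ (x : ∀ i, Word (t i)) (j : Fin n),
    dec j (fun J => enc J (fun i => x i)) (fun i => x i) = x j

/-- The tuple `R` of (nonnegative) rates is achievable with link capacities `C`. -/
def Achievable {n : ℕ} (P : Problem n) (C : Server n → ℝ) (R : Fin n → ℝ) : Prop :=
  (∀ j, 0 ≤ R j) ∧
  ∃ (t : Fin n → ℕ) (u : Server n → ℕ) (r : ℝ), 0 < r ∧ Nonempty (Code P t u) ∧
    (∀ j, R j ≤ (t j : ℝ) / r) ∧ (∀ J, (u J : ℝ) / r ≤ C J)

/-- The capacity region for given link capacities: the closure of the set of achievable rate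
tuples. -/
def capacityRegion {n : ℕ} (P : Problem n) (C : Server n → ℝ) : Set (Fin n → ℝ) :=
  closure {R | Achievable P C R}

/-- The symmetric distributed problem: every server has link capacity `1`. -/
def unitCapacity (n : ℕ) : Server n → ℝ := fun _ => 1

/-- The centralized problem: the server holding all messages has link capacity `1`, every other
server has link capacity `0`. -/
def centralCapacity (n : ℕ) : Server n → ℝ := fun J => if J.1 = Finset.univ then 1 else 0

/-- The set of sum rates of the members of a set of rate tuples. -/
def sumRates {n : ℕ} (S : Set (Fin n → ℝ)) : Set ℝ := (fun R => ∑ j, R j) '' S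

/-- The problem `(1);(2|3);(3|2)`. -/
def problemA : Problem 3 where
  side := ![∅, {2}, {1}]
  not_mem_side := by decide

/-- The problem `(1|3);(2|3);(3|2)`. -/
def problemB : Problem 3 where
  side := ![{2}, {2}, {1}]
  not_mem_side := by decide

end IndexCoding

/-! Upper bounds: if server outputs, evaluated at the true messages or at modified ones, determine
every message, then the total message length is at most the total length of those outputs.
Overwriting side information with a default makes it known, so decoding works in stages. `problemA`
needs 7 + 2 outputs and `problemB` 6 + 4; explicit linear codes attain 9 and 10.

Centralized case: let `S` be the set of vertices reachable from `j`. As `i → j` is on no cycle, `i ∉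
S`, and no receiver outside `S` knows a message in `S`. Let `F z` be the set of words sent when the
messages outside `S` are `z` and those in `S` vary, with `z₀` minimizing `#(F z)`. The word for `z₀`
serves `S` without outside information, and takes at most `#(F z₀)` values. Any word of `F z` serves
the receivers outside `S`, so it may come from a set meeting every `F z`. For `k` copies, greedy
covering gives such a set of size about `(#Q / #(F z₀)) ^ k`, where `Q` is the set of all words. The
product is `#Q ^ k` up to a factor linear in `k`, which costs no rate in the limit
(`exists_separating_power`). -/

namespace IndexCoding

open Finset Filter Topology

/-! ### Codes and separating families of functions -/

section Codes

variable {n : ℕ} {P : Problem n} {t : Fin n → ℕ} {u : Server n → ℕ}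

/-- The output of server `J` for the messages `x`. -/
def Code.out (c : Code P t u) (x : ∀ i, Word (t i)) (J : Server n) : Word (u J) :=
  c.enc J (fun i => x i)

theorem Code.out_congr (c : Code P t u) {x x' : ∀ i, Word (t i)} {J : Server n}
    (h : ∀ i ∈ J.1, x i = x' i) : c.out x J = c.out x' J := by
  unfold Code.out
  congr 1
  funext i
  exact h i.1 i.2

theorem Code.eq_of_out_eq (c : Code P t u) {x x' : ∀ i, Word (t i)} (j : Fin n)
    (h : c.out x = c.out x') (hs : ∀ i ∈ P.side j, x i = x' i) : x j = x' j := by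
  rw [← c.exact_recovery x j, ← c.exact_recovery x' j]
  have h1 : (fun i : {i // i ∈ P.side j} => x i) = fun i : {i // i ∈ P.side j} => x' i :=
    funext fun i => hs i.1 i.2
  have h2 : (fun J : Server n => c.enc J (fun i => x i)) = fun J => c.enc J (fun i => x' i) := h
  rw [h1, h2]

/-- A family of local functions of the messages which, together with the side information,
determines the wanted message of every receiver, gives an index code. -/
theorem nonempty_code_of_separating
    (Y : ∀ J : Server n, (∀ i, Word (t i)) → Word (u J))
    (hloc : ∀ J x x', (∀ i ∈ J.1, x i = x' i) → Y J x = Y J x')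
    (hdec : ∀ j x x', (∀ J, Y J x = Y J x') → (∀ i ∈ P.side j, x i = x' i) → x j = x' j) :
    Nonempty (Code P t u) := by
  classical
  refine ⟨{
    enc := fun J w => Y J (fun i => if h : i ∈ J.1 then w ⟨i, h⟩ else default)
    dec := fun j y w =>
      if h : ∃ x : ∀ i, Word (t i), (∀ J, Y J x = y J) ∧ ∀ i : {i // i ∈ P.side j}, x i = w i
      then h.choose j else default
    exact_recovery := ?_ }⟩
  intro x j
  have hY : ∀ J : Server n,
      Y J (fun i => if i ∈ J.1 then x i else default) = Y J x := fun J =>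
    hloc J _ _ fun i hi => by simp [hi]
  have hex : ∃ x' : ∀ i, Word (t i),
      (∀ J : Server n, Y J x' = Y J (fun i => if _ : i ∈ J.1 then x i else default)) ∧
        ∀ i : {i // i ∈ P.side j}, x' i = x i :=
    ⟨x, fun J => (hY J).symm, fun _ => rfl⟩
  rw [dif_pos hex]
  exact hdec j _ _ (fun J => (hex.choose_spec.1 J).trans (hY J))
    fun i hi => hex.choose_spec.2 ⟨i, hi⟩

/-- If a function with at most `2 ^ N` values separates the messages of every receiver, there is
an index code in which only the server holding all messages transmits, and sends `N` bits. -/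
theorem nonempty_code_of_card_le {κ : Type*} [Fintype κ] {N : ℕ} (hN : Fintype.card κ ≤ 2 ^ N)
    (hn : 0 < n) (φ : (∀ i, Word (t i)) → κ)
    (hφ : ∀ j x x', φ x = φ x' → (∀ i ∈ P.side j, x i = x' i) → x j = x' j) :
    Nonempty (Code P t fun J => if J.1 = univ then N else 0) := by
  obtain ⟨e⟩ : Nonempty (κ ↪ Word N) :=
    Function.Embedding.nonempty_of_card_le (by simpa using hN)
  have : Nonempty (Fin n) := ⟨⟨0, hn⟩⟩
  -- The output length is itself an `if`; indexing by `a.1` avoids casts, and the `false` branch is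
  -- never reached.
  refine nonempty_code_of_separating
    (fun J x a => if h : a.1 < N then e (φ x) ⟨a.1, h⟩ else false) ?_ ?_
  · intro J x x' h
    funext a
    by_cases hJ : J.1 = univ
    · have : x = x' := funext fun i => h i (by simp [hJ])
      rw [this]
    · have := a.2
      simp [hJ] at this
  · intro j x x' h hs
    refine hφ j x x' (e.injective (funext fun a => ?_)) hs
    have h1 := congrFun (h ⟨univ, univ_nonempty⟩) ⟨a.1, by simp⟩
    simpa using h1

theorem card_words {ι : Type*} [Fintype ι] [DecidableEq ι] (u : ι → ℕ) :
    Fintype.card (∀ i, Word (u i)) = 2 ^ ∑ i, u i := by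
  simp [Fintype.card_pi, Finset.prod_pow_eq_pow_sum]

end Codes

/-! ### The two distributed problems -/

/-- A bound on the sum of all message lengths by the sum of the link lengths, with multiplicities,
gives a bound on the sum rate. -/
theorem sum_le_of_forall_code {n : ℕ} {P : Problem n} (p q : Server n → Prop)
    [DecidablePred p] [DecidablePred q]
    (h : ∀ (t : Fin n → ℕ) (u : Server n → ℕ), Code P t u →
      ∑ j, t j ≤ ∑ J : {J // p J}, u J + ∑ J : {J // q J}, u J)
    {x : ℝ} (hx : x ∈ sumRates (capacityRegion P (unitCapacity n))) :
    x ≤ Fintype.card {J // p J} + Fintype.card {J // q J} := by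
  obtain ⟨R, hR, rfl⟩ := hx
  refine closure_minimal (t := {R : Fin n → ℝ |
    ∑ j, R j ≤ Fintype.card {J // p J} + Fintype.card {J // q J}}) ?_
    (isClosed_le (by fun_prop) continuous_const) hR
  rintro R ⟨-, t, u, r, hr, ⟨c⟩, ht, hu⟩
  have hu' : ∀ J, (u J : ℝ) ≤ r := fun J => by
    have := hu J
    rwa [unitCapacity, div_le_one hr] at this
  have h1 : ((∑ j, t j : ℕ) : ℝ) ≤
      ((∑ J : {J // p J}, u J + ∑ J : {J // q J}, u J : ℕ) : ℝ) := by exact_mod_cast h t u c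
  have hsum : ∀ (s : Server n → Prop) [DecidablePred s],
      ∑ J : {J // s J}, (u J : ℝ) ≤ Fintype.card {J // s J} * r := fun s _ => by
    simpa using Finset.sum_le_sum fun (J : {J // s J}) (_ : J ∈ univ) => hu' J
  push_cast at h1
  show ∑ j, R j ≤ _
  calc ∑ j, R j ≤ ∑ j, (t j : ℝ) / r := Finset.sum_le_sum fun j _ => ht j
    _ = (∑ j, (t j : ℝ)) / r := by rw [Finset.sum_div]
    _ ≤ _ := by
      rw [div_le_iff₀ hr]
      linarith [hsum p, hsum q]

theorem sum_le_of_injective {n : ℕ} {t : Fin n → ℕ} {u : Server n → ℕ} {p q : Server n → Prop}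
    [DecidablePred p] [DecidablePred q]
    (φ : (∀ i, Word (t i)) → (∀ J : {J // p J}, Word (u J)) × (∀ J : {J // q J}, Word (u J)))
    (hφ : Function.Injective φ) :
    ∑ j, t j ≤ ∑ J : {J // p J}, u J + ∑ J : {J // q J}, u J := by
  have h := Fintype.card_le_of_injective φ hφ
  rw [Fintype.card_prod, card_words, card_words, card_words, ← pow_add] at h
  exact (Nat.pow_le_pow_iff_right (by norm_num)).1 h

/-- All true outputs give message 0. With message 1 overwritten, only the two servers holding both 1
and 2 have outputs not yet determined; supplying these gives message 2, and then the true outputs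
give message 1. -/
theorem problemA_sum_le {x : ℝ}
    (hx : x ∈ sumRates (capacityRegion problemA (unitCapacity 3))) : x ≤ 9 := by
  have key := sum_le_of_forall_code (P := problemA) (fun _ => True)
    (fun J => 1 ∈ J.1 ∧ 2 ∈ J.1) ?_ hx
  · have h1 : Fintype.card {J : Server 3 // True} = 7 := by decide
    have h2 : Fintype.card {J : Server 3 // 1 ∈ J.1 ∧ 2 ∈ J.1} = 2 := by decide
    rw [h1, h2] at key
    norm_num at key
    exact key
  intro t u c
  refine sum_le_of_injective (fun x => (fun J => c.out x J,
    fun J => c.out (Function.update x 1 default) J)) ?_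
  intro x x' h
  obtain ⟨h1, h2⟩ := Prod.mk.inj h
  have hout : c.out x = c.out x' := funext fun J => congrFun h1 ⟨J, trivial⟩
  have e0 : x 0 = x' 0 := c.eq_of_out_eq 0 hout (by simp [problemA])
  have e2 : x 2 = x' 2 := by
    have := c.eq_of_out_eq (x := Function.update x 1 default)
      (x' := Function.update x' 1 default) 2 ?_ (by simp [problemA])
    · simpa using this
    funext J
    by_cases j1 : 1 ∈ J.1
    · by_cases j2 : 2 ∈ J.1
      · exact congrFun h2 ⟨J, j1, j2⟩
      · refine c.out_congr fun i hi => ?_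
        fin_cases i
        · simpa using e0
        · simp
        · exact absurd hi j2
    · have hupd : ∀ y : ∀ i, Word (t i), c.out (Function.update y 1 default) J = c.out y J :=
        fun y => c.out_congr fun i hi => by
          rw [Function.update_of_ne]
          rintro rfl
          exact j1 hi
      rw [hupd, hupd, hout]
  have e1 : x 1 = x' 1 := c.eq_of_out_eq 1 hout (by simpa [problemA] using e2)
  funext i
  fin_cases i
  exacts [e0, e1, e2]

/-- Overwriting message 2, the only side information of receivers 0 and 1, lets both decode, and
makes the output of server `{2}` constant. Overwriting messages 0 and 1 then leaves only the four
servers holding 2 informative, and receiver 2 decodes. -/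
theorem problemB_sum_le {x : ℝ}
    (hx : x ∈ sumRates (capacityRegion problemB (unitCapacity 3))) : x ≤ 10 := by
  have key := sum_le_of_forall_code (P := problemB) (fun J => J.1 ≠ {2})
    (fun J => 2 ∈ J.1) ?_ hx
  · have h1 : Fintype.card {J : Server 3 // J.1 ≠ {2}} = 6 := by decide
    have h2 : Fintype.card {J : Server 3 // 2 ∈ J.1} = 4 := by decide
    rw [h1, h2] at key
    norm_num at key
    exact key
  intro t u c
  refine sum_le_of_injective (fun x => (fun J => c.out (Function.update x 2 default) J,
    fun J => c.out (Function.update (Function.update x 0 default) 1 default) J)) ?_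
  intro x x' h
  obtain ⟨h1, h2⟩ := Prod.mk.inj h
  have hout : c.out (Function.update x 2 default) = c.out (Function.update x' 2 default) := by
    funext J
    by_cases hJ : J.1 = {2}
    · refine c.out_congr fun i hi => ?_
      rw [hJ, mem_singleton] at hi
      subst hi
      simp
    · exact congrFun h1 ⟨J, hJ⟩
  have e0 : x 0 = x' 0 := by
    simpa using c.eq_of_out_eq 0 hout (by simp [problemB])
  have e1 : x 1 = x' 1 := by
    simpa using c.eq_of_out_eq 1 hout (by simp [problemB])
  have e2 : x 2 = x' 2 := by
    have := c.eq_of_out_eq (x := Function.update (Function.update x 0 default) 1 default)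
      (x' := Function.update (Function.update x' 0 default) 1 default) 2 ?_ (by simp [problemB])
    · simpa using this
    funext J
    by_cases j2 : 2 ∈ J.1
    · exact congrFun h2 ⟨J, j2⟩
    · refine c.out_congr fun i hi => ?_
      fin_cases i
      · simp
      · simp
      · exact absurd hi j2
  funext i
  fin_cases i
  exacts [e0, e1, e2]

theorem sum_mem_sumRates_of_code {n : ℕ} {P : Problem n} {t : Fin n → ℕ}
    (h : Nonempty (Code P t fun _ => 1)) :
    ∑ j, (t j : ℝ) ∈ sumRates (capacityRegion P (unitCapacity n)) :=
  ⟨fun j => t j, subset_closure ⟨fun j => Nat.cast_nonneg _, t, fun _ => 1, 1, one_pos, h,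
    by simp, by simp [unitCapacity]⟩, rfl⟩

/-- The server outputs of an optimal code for `problemA`. -/
def outputA (J : Server 3) (x : Fin 3 → Word 3) : Bool :=
  if 0 ∈ J.1 then
    if 1 ∈ J.1 then
      if 2 ∈ J.1 then xor (x 1 2) (x 2 2) else x 0 1
    else
      if 2 ∈ J.1 then x 0 2 else x 0 0
  else
    if 1 ∈ J.1 then
      if 2 ∈ J.1 then xor (x 1 1) (x 2 1) else x 1 0
    else x 2 0

/-- Message 0 is sent uncoded; messages 1 and 2 share two servers through xors, each receiver
cancelling the other's bit. -/
theorem nonempty_code_problemA : Nonempty (Code problemA (fun _ => 3) fun _ => 1) := by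
  refine nonempty_code_of_separating (fun J x _ => outputA J x) ?_ ?_
  · intro J x x' h
    funext _
    have hne : 0 ∉ J.1 → 1 ∉ J.1 → 2 ∈ J.1 := by
      obtain ⟨i, hi⟩ := J.2
      fin_cases i <;> simp_all
    unfold outputA
    split_ifs with h0 h1 h2 h2 h1 h2 <;> simp_all
  · intro j x x' h hs
    have g := fun J => congrFun (h J) 0
    have g0 := g ⟨{0}, by decide⟩
    have g1 := g ⟨{1}, by decide⟩
    have g2 := g ⟨{2}, by decide⟩
    have g01 := g ⟨{0, 1}, by decide⟩
    have g02 := g ⟨{0, 2}, by decide⟩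
    have g12 := g ⟨{1, 2}, by decide⟩
    have g012 := g ⟨{0, 1, 2}, by decide⟩
    simp [outputA] at g0 g1 g2 g01 g02 g12 g012
    funext a
    fin_cases j <;> fin_cases a <;> simp_all [problemA]

/-- The message lengths of an optimal code for `problemB`. -/
def lengthB : Fin 3 → ℕ := ![2, 4, 4]

/-- The server outputs of an optimal code for `problemB`. -/
def outputB (J : Server 3) (a : Word 2) (b c : Word 4) : Bool :=
  if 0 ∈ J.1 then
    if 1 ∈ J.1 then
      if 2 ∈ J.1 then xor (b 3) (c 3) else xor (a 1) (b 1)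
    else
      if 2 ∈ J.1 then xor (a 1) (c 1) else a 0
  else
    if 1 ∈ J.1 then
      if 2 ∈ J.1 then xor (b 2) (c 2) else b 0
    else c 0

/-- The gain is the bit `a 1`, sent twice, masked by `b 1` and by `c 1`. Receivers 0 and 1 know `c`
and receiver 2 knows `b`, so each unmasks `a 1`; receivers 1 and 2 then use it to extract their own
bit from the other xor. -/
theorem nonempty_code_problemB : Nonempty (Code problemB lengthB fun _ => 1) := by
  refine nonempty_code_of_separating (fun J x _ => outputB J (x 0) (x 1) (x 2)) ?_ ?_
  · intro J x x' h
    funext _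
    have hne : 0 ∉ J.1 → 1 ∉ J.1 → 2 ∈ J.1 := by
      obtain ⟨i, hi⟩ := J.2
      fin_cases i <;> simp_all
    unfold outputB
    split_ifs with h0 h1 h2 h2 h1 h2 <;> simp_all
  · intro j x x' h hs
    have g := fun J => congrFun (h J) 0
    have g0 := g ⟨{0}, by decide⟩
    have g1 := g ⟨{1}, by decide⟩
    have g2 := g ⟨{2}, by decide⟩
    have g01 := g ⟨{0, 1}, by decide⟩
    have g02 := g ⟨{0, 2}, by decide⟩
    have g12 := g ⟨{1, 2}, by decide⟩
    have g012 := g ⟨{0, 1, 2}, by decide⟩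
    simp [outputB] at g0 g1 g2 g01 g02 g12 g012
    have w2 : ∀ {y y' : Word 2}, y 0 = y' 0 → y 1 = y' 1 → y = y' := fun h0 h1 =>
      funext fun a => by fin_cases a <;> assumption
    have w4 : ∀ {y y' : Word 4}, y 0 = y' 0 → y 1 = y' 1 → y 2 = y' 2 → y 3 = y' 3 → y = y' :=
      fun h0 h1 h2 h3 => funext fun a => by fin_cases a <;> assumption
    fin_cases j
    · have h2 : x 2 = x' 2 := hs 2 (by simp [problemB])
      exact w2 g0 (by simpa [h2] using g02)
    · have h2 : x 2 = x' 2 := hs 2 (by simp [problemB])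
      rw [h2] at g02 g12 g012
      have ha := Bool.xor_left_inj.1 g02
      exact w4 g1 (by simpa [ha] using g01) (by simpa using g12) (by simpa using g012)
    · have h1 : x 1 = x' 1 := hs 1 (by simp [problemB])
      rw [h1] at g01 g12 g012
      have ha := Bool.xor_left_inj.1 g01
      exact w4 g2 (by simpa [ha] using g02) (by simpa using g12) (by simpa using g012)

theorem isGreatest_sumRates_problemA :
    IsGreatest (sumRates (capacityRegion problemA (unitCapacity 3))) 9 := by
  refine ⟨?_, fun _ => problemA_sum_le⟩
  have := sum_mem_sumRates_of_code nonempty_code_problemA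
  norm_num at this
  exact this

theorem isGreatest_sumRates_problemB :
    IsGreatest (sumRates (capacityRegion problemB (unitCapacity 3))) 10 := by
  refine ⟨?_, fun _ => problemB_sum_le⟩
  have := sum_mem_sumRates_of_code nonempty_code_problemB
  rwa [show ∑ j, (lengthB j : ℝ) = 10 by
    rw [← Nat.cast_sum, show ∑ j, lengthB j = 10 by decide]; norm_num] at this

theorem not_onDirectedCycle_problemB : ¬ OnDirectedCycle problemB.graph 2 0 := by
  rintro ⟨k, p, hk, -, hp, hadj, m, hm, -, hm0⟩
  have hout : ∀ v, ¬ problemB.graph.Adj 0 v := by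
    intro v hv
    change (0 : Fin 3) ∈ problemB.side v at hv
    revert hv
    revert v
    decide
  -- The cycle must leave vertex 0 again, which has no outgoing edge; if `m + 1 = k`, it does so at
  -- index 0.
  rcases (Nat.succ_le_of_lt hm).eq_or_lt with h | h
  · have := hadj 0 hk
    rw [← hp, ← h, hm0] at this
    exact hout _ this
  · have := hadj (m + 1) h
    rw [hm0] at this
    exact hout _ this

theorem removeEdge_problemB : problemB.removeEdge 2 0 = problemA := by
  ext1
  funext j
  fin_cases j <;> decide

/-! ### Directed cycles -/

/-- An edge `i → j` with a directed path from `j` to `i` lies on a directed cycle. -/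
theorem onDirectedCycle_of_reachable {V : Type*} {G : Digraph V} {i j : V} (hij : G.Adj i j)
    (h : Relation.ReflTransGen G.Adj j i) : OnDirectedCycle G i j := by
  classical
  have hwalk : ∃ k : ℕ, ∃ p : ℕ → V, p 0 = i ∧ p 1 = j ∧ 0 < k ∧ p k = i ∧
      ∀ m < k, G.Adj (p m) (p (m + 1)) := by
    have hw : ∀ v, Relation.ReflTransGen G.Adj j v → ∃ k : ℕ, ∃ p : ℕ → V, p 0 = i ∧ p 1 = j ∧
        0 < k ∧ p k = v ∧ ∀ m < k, G.Adj (p m) (p (m + 1)) := by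
      intro v hv
      induction hv with
      | refl =>
        refine ⟨1, fun m => if m = 0 then i else j, by simp, by simp, one_pos, by simp, ?_⟩
        intro m hm
        obtain rfl : m = 0 := by omega
        simpa using hij
      | @tail a b _ hab ih =>
        obtain ⟨k, p, h0, h1, hk, hpk, hp⟩ := ih
        refine ⟨k + 1, fun m => if m ≤ k then p m else b, by simp [h0], ?_, by omega, by simp, ?_⟩
        · simp [Nat.succ_le_of_lt hk, h1]
        · intro m hm
          rcases (Nat.lt_succ_iff.1 hm).eq_or_lt with rfl | hlt
          · simpa [hpk] using hab
          · simpa [hlt.le, Nat.succ_le_of_lt hlt] using hp m hlt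
    exact hw i h
  obtain ⟨p, h0, h1, hk, hpk, hp⟩ := Nat.find_spec hwalk
  -- In a shortest closed walk starting with `i → j`, a repeated vertex would allow a shortcut that
  -- keeps this first edge.
  have hmin := fun m => Nat.find_min (m := m) hwalk
  set k := Nat.find hwalk with hkdef
  clear_value k
  have hinj : ∀ a b, a < b → b < k → p a ≠ p b := by
    intro a b hab hbk heq
    rcases Nat.eq_zero_or_pos a with rfl | ha
    · exact hmin b hbk ⟨p, h0, h1, hab, by rw [← heq, h0], fun m hm => hp m (hm.trans hbk)⟩
    · refine hmin (k - (b - a)) (by omega) ⟨fun m => if m ≤ a then p m else p (m + (b - a)),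
        by simp [h0], by simp [Nat.succ_le_of_lt ha, h1], by omega, ?_, ?_⟩
      · change (if _ then _ else _) = _
        rw [if_neg (by omega), show k - (b - a) + (b - a) = k by omega, hpk]
      · intro m hm
        rcases lt_trichotomy m a with hlt | rfl | hgt
        · simpa [hlt.le, Nat.succ_le_of_lt hlt] using hp m (by omega)
        · have := hp b hbk
          simp only [le_refl, if_true, if_neg (show ¬ m + 1 ≤ m by omega)]
          rwa [heq, show m + 1 + (b - m) = b + 1 by omega]
        · have := hp (m + (b - a)) (by omega)
          simp only [if_neg (show ¬ m ≤ a by omega), if_neg (show ¬ m + 1 ≤ a by omega)]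
          rwa [show m + 1 + (b - a) = m + (b - a) + 1 by omega]
  refine ⟨k, p, hk, ?_, by rw [hpk, h0], hp, 0, hk, h0, h1⟩
  intro a ha b hb heq
  rcases lt_trichotomy a b with hlt | rfl | hgt
  · exact absurd heq (hinj a b hlt hb)
  · rfl
  · exact absurd heq.symm (hinj b a hgt ha)

/-! ### Fractional coverings -/

/-- Greedy covering: if every `F v` contains a proportion at least `p` of all points, then `m`
points can be chosen such that at most a proportion `(1 - p) ^ m` of the sets is missed. -/
theorem exists_finset_card_missed_le {V Q : Type*} [Fintype V] [Fintype Q] [Nonempty Q]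
    [DecidableEq Q] (F : V → Finset Q) {p : ℝ} (hp1 : p ≤ 1)
    (hp : ∀ v, p * Fintype.card Q ≤ #(F v)) (m : ℕ) :
    ∃ G : Finset Q, #G ≤ m ∧
      (#{v | Disjoint G (F v)} : ℝ) ≤ Fintype.card V * (1 - p) ^ m := by
  induction m with
  | zero => exact ⟨∅, by simp, by simp⟩
  | succ m ih =>
    obtain ⟨G, hG, hGm⟩ := ih
    set U : Finset V := {v | Disjoint G (F v)} with hU
    have hsum : ∑ q : Q, (#{v ∈ U | q ∉ F v} : ℝ) ≤ ∑ _q : Q, (#U : ℝ) * (1 - p) := by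
      have hswap : ∑ q : Q, #{v ∈ U | q ∉ F v} = ∑ v ∈ U, #{q | q ∉ F v} := by
        simp only [card_filter]
        exact Finset.sum_comm
      rw [← Nat.cast_sum, hswap, Nat.cast_sum, sum_const, nsmul_eq_mul, card_univ]
      calc ∑ v ∈ U, (#{q | q ∉ F v} : ℝ) ≤ ∑ v ∈ U, (Fintype.card Q : ℝ) * (1 - p) := by
            refine Finset.sum_le_sum fun v _ => ?_
            have h1 : #{q | q ∉ F v} + #(F v) = Fintype.card Q := by
              have : ({q | q ∉ F v} : Finset Q) = (F v)ᶜ := by ext; simp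
              rw [this, card_compl_add_card]
            have h2 : (#{q | q ∉ F v} : ℝ) + #(F v) = Fintype.card Q := by exact_mod_cast h1
            linarith [hp v]
        _ = _ := by rw [sum_const, nsmul_eq_mul]; ring
    -- Averaging: some point is missed by at most a proportion `1 - p` of the sets still unmet.
    obtain ⟨q, -, hq⟩ := exists_le_of_sum_le univ_nonempty hsum
    refine ⟨insert q G, (card_insert_le _ _).trans (by omega), ?_⟩
    have hset : ({v | Disjoint (insert q G) (F v)} : Finset V) = {v ∈ U | q ∉ F v} := by
      ext v
      simp [hU, disjoint_insert_left, and_comm]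
    rw [hset, pow_succ, ← mul_assoc]
    exact hq.trans (mul_le_mul_of_nonneg_right hGm (by linarith))

/-- If every `F v` has at least `b` points, the `k`-fold products of the sets `F v` can be met by
about `(card Q / b) ^ k` points, up to a factor linear in `k`. -/
theorem exists_finset_meeting_pi {V Q : Type*} [Fintype V] [Fintype Q] [Nonempty Q]
    [DecidableEq Q] (F : V → Finset Q) {b T : ℕ} (hb0 : 0 < b) (hbQ : b ≤ Fintype.card Q)
    (hb : ∀ v, b ≤ #(F v)) (hT : Fintype.card V ≤ 2 ^ T) (k : ℕ) :
    ∃ G : Finset (Fin k → Q), b ^ k * #G ≤ Fintype.card Q ^ k * (k * T + 2) ∧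
      ∀ v : Fin k → V, ∃ g ∈ G, ∀ l, g l ∈ F (v l) := by
  classical
  set q := Fintype.card Q with hq
  have hq0 : (0 : ℝ) < (q : ℝ) ^ k := pow_pos (by exact_mod_cast hb0.trans_le hbQ) k
  have hbk : (0 : ℝ) < (b : ℝ) ^ k := pow_pos (by exact_mod_cast hb0) k
  have hbq : (b : ℝ) ^ k ≤ (q : ℝ) ^ k := by gcongr
  set p : ℝ := (b : ℝ) ^ k / (q : ℝ) ^ k with hp
  have hp0 : 0 < p := div_pos hbk hq0
  have hp1 : p ≤ 1 := (div_le_one hq0).2 hbq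
  -- Chosen so that the number of missed tuples is at most `exp (k * T) * exp (-(k * T + 1)) < 1`,
  -- hence zero.
  set m : ℕ := ⌈(k * T + 1 : ℝ) / p⌉₊ with hm
  obtain ⟨G, hGm, hG⟩ := exists_finset_card_missed_le
    (fun v : Fin k → V => Fintype.piFinset fun l => F (v l)) (p := p) hp1 (fun v => by
      rw [Fintype.card_pi, Fintype.card_piFinset]
      simp only [prod_const, card_univ, Fintype.card_fin, ← hq]
      push_cast
      rw [hp, div_mul_cancel₀ _ hq0.ne']
      calc (b : ℝ) ^ k = ∏ _l : Fin k, (b : ℝ) := by simp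
        _ ≤ ∏ l, (#(F (v l)) : ℝ) :=
          Finset.prod_le_prod (fun _ _ => by positivity) fun l _ => by exact_mod_cast hb (v l)) m
  refine ⟨G, ?_, ?_⟩
  · have h1 : (#G : ℝ) ≤ (k * T + 1 : ℝ) / p + 1 :=
      (by exact_mod_cast hGm : (#G : ℝ) ≤ m).trans (Nat.ceil_lt_add_one (by positivity)).le
    have h2 : (b : ℝ) ^ k * #G ≤ (q : ℝ) ^ k * (k * T + 2) := by
      calc (b : ℝ) ^ k * #G ≤ (b : ℝ) ^ k * ((k * T + 1 : ℝ) / p + 1) := by gcongr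
        _ = (q : ℝ) ^ k * (k * T + 1) + (b : ℝ) ^ k := by
          rw [hp]; field_simp
        _ ≤ _ := by linarith
    exact_mod_cast h2
  · have hlt : (#{v : Fin k → V | Disjoint G (Fintype.piFinset fun l => F (v l))} : ℝ) < 1 := by
      refine hG.trans_lt ?_
      have hcard : (Fintype.card (Fin k → V) : ℝ) ≤ Real.exp (k * T) := by
        have h2e : (2 : ℝ) ≤ Real.exp 1 := by linarith [Real.add_one_le_exp (1 : ℝ)]
        calc (Fintype.card (Fin k → V) : ℝ) = (Fintype.card V : ℝ) ^ k := by simp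
          _ ≤ ((2 : ℝ) ^ T) ^ k := by gcongr; exact_mod_cast hT
          _ ≤ (Real.exp 1 ^ T) ^ k := by gcongr
          _ = Real.exp (k * T) := by
            rw [← pow_mul, ← Real.exp_nat_mul]; push_cast; ring_nf
      have hpow : (1 - p) ^ m ≤ Real.exp (-(k * T + 1)) := by
        calc (1 - p) ^ m ≤ Real.exp (-p) ^ m :=
              pow_le_pow_left₀ (by linarith) (Real.one_sub_le_exp_neg p) m
          _ = Real.exp (-(m * p)) := by rw [← Real.exp_nat_mul]; ring_nf
          _ ≤ _ := by
            refine Real.exp_le_exp.2 (neg_le_neg ?_)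
            rw [← div_le_iff₀ hp0]
            exact Nat.le_ceil _
      calc (Fintype.card (Fin k → V) : ℝ) * (1 - p) ^ m
          ≤ Real.exp (k * T) * Real.exp (-(k * T + 1)) :=
            mul_le_mul hcard hpow (pow_nonneg (by linarith) _) (Real.exp_pos _).le
        _ = Real.exp (-1) := by rw [← Real.exp_add]; ring_nf
        _ < 1 := by rw [Real.exp_lt_one_iff]; norm_num
    have hempty := card_eq_zero.1 (Nat.lt_one_iff.1 (by exact_mod_cast hlt))
    intro v
    have hv : ¬ Disjoint G (Fintype.piFinset fun l => F (v l)) := fun h => by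
      have : v ∈ ({v : Fin k → V | Disjoint G (Fintype.piFinset fun l => F (v l))} :
        Finset _) := by simpa using h
      rw [hempty] at this
      exact absurd this (notMem_empty v)
    obtain ⟨g, hg, hgF⟩ := not_disjoint_iff.1 hv
    exact ⟨g, hg, fun l => Fintype.mem_piFinset.1 hgF l⟩

/-! ### Separating the receivers by a closed set of vertices -/

/-- Let `S` be a set of messages which no receiver outside `S` knows, and let `Y` separate the
messages of the receivers of `P`. Then side information from outside `S` is of no use to the
receivers in `S`: without it, `k` copies of the messages are separated by a function that has at
most a factor linear in `k` more values than `k` copies of `Y`. -/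
theorem exists_separating_power {n : ℕ} {P P' : Problem n} (S : Set (Fin n))
    (hin : ∀ j ∈ S, ∀ i ∈ P.side j, i ∈ S → i ∈ P'.side j)
    (hout : ∀ j ∉ S, ∀ i ∈ P.side j, i ∉ S ∧ i ∈ P'.side j)
    {W : Fin n → Type} [∀ i, Fintype (W i)] [∀ i, Nonempty (W i)] {Q : Type} [Fintype Q]
    (Y : (∀ i, W i) → Q)
    (hY : ∀ j x x', Y x = Y x' → (∀ i ∈ P.side j, x i = x' i) → x j = x' j)
    {T : ℕ} (hT : Fintype.card (∀ i, W i) ≤ 2 ^ T) (k : ℕ) :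
    ∃ (κ : Type) (_ : Fintype κ) (φ : (Fin k → ∀ i, W i) → κ),
      Fintype.card κ ≤ Fintype.card Q ^ k * (k * T + 2) ∧
      ∀ j x x', φ x = φ x' → (∀ i ∈ P'.side j, ∀ l, x l i = x' l i) → ∀ l, x l j = x' l j := by
  classical
  let glue : (∀ i, W i) → (∀ i, W i) → ∀ i, W i := fun x z i => if i ∈ S then x i else z i
  let F : (∀ i, W i) → Finset Q := fun z => univ.image fun x => Y (glue x z)
  obtain ⟨z₀, -, hz₀⟩ := exists_min_image univ (fun z => #(F z)) univ_nonempty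
  have : Nonempty Q := ⟨Y z₀⟩
  have hmem : ∀ x z, Y (glue x z) ∈ F z := fun x z => mem_image_of_mem _ (mem_univ x)
  obtain ⟨G, hGcard, hG⟩ := exists_finset_meeting_pi F (card_pos.2 ⟨_, hmem z₀ z₀⟩)
    (card_le_univ (F z₀)) (fun v => hz₀ v (mem_univ v)) hT k
  choose g hgG hgF using hG
  refine ⟨(Fin k → F z₀) × G, inferInstance,
    fun x => (fun l => ⟨Y (glue (x l) z₀), hmem _ _⟩, ⟨g x, hgG x⟩), by simpa using hGcard, ?_⟩
  intro j x x' hφ hs l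
  obtain ⟨h1, h2⟩ := Prod.mk.inj hφ
  by_cases hj : j ∈ S
  · have hl : Y (glue (x l) z₀) = Y (glue (x' l) z₀) := congrArg Subtype.val (congrFun h1 l)
    have := hY j _ _ hl fun i hi => by
      by_cases hiS : i ∈ S
      · simpa [glue, hiS] using hs i (hin j hj i hi hiS) l
      · simp [glue, hiS]
    simpa [glue, hj] using this
  · have hg : g x = g x' := congrArg Subtype.val h2
    -- The common word `g x l` arises from unknown messages `y`, `y'` in `S`; these may differ,
    -- since receivers outside `S` know none of them.
    obtain ⟨y, -, hy⟩ := mem_image.1 (hgF x l)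
    obtain ⟨y', -, hy'⟩ := mem_image.1 (hgF x' l)
    have := hY j (glue y (x l)) (glue y' (x' l)) (hy.trans ((congrFun hg l).trans hy'.symm))
      fun i hi => by
        obtain ⟨hiS, hi'⟩ := hout j hj i hi
        simpa [glue, hiS] using hs i hi' l
    simpa [glue, hj] using this

/-! ### Centralized problems -/

theorem Achievable.of_side_subset {n : ℕ} {P P' : Problem n} {C : Server n → ℝ} {R : Fin n → ℝ}
    (h : ∀ j, P'.side j ⊆ P.side j) (hR : Achievable P' C R) : Achievable P C R := by
  obtain ⟨h0, t, u, r, hr, ⟨c⟩, ht, hu⟩ := hR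
  exact ⟨h0, t, u, r, hr, ⟨⟨c.enc, fun j y w => c.dec j y fun i => w ⟨i, h j i.2⟩,
    c.exact_recovery⟩⟩, ht, hu⟩

/-- Taking `2 ^ s` copies costs only `s + T + 2` extra bits, so the rates shrink by a factor tending
to 1, and the closure absorbs the loss. -/
theorem Achievable.mem_capacityRegion_of_closed {n : ℕ} {P P' : Problem n} (hn : 0 < n)
    (S : Set (Fin n)) (hin : ∀ j ∈ S, ∀ i ∈ P.side j, i ∈ S → i ∈ P'.side j)
    (hout : ∀ j ∉ S, ∀ i ∈ P.side j, i ∉ S ∧ i ∈ P'.side j) {R : Fin n → ℝ}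
    (hR : Achievable P (centralCapacity n) R) : R ∈ capacityRegion P' (centralCapacity n) := by
  obtain ⟨h0, t, u, r, hr, ⟨c⟩, ht, hu⟩ := hR
  have : Nonempty (Fin n) := ⟨⟨0, hn⟩⟩
  set T : ℕ := ∑ i, t i with hT
  set U : ℕ := ∑ J, u J with hU
  have hUr : (U : ℝ) ≤ r := by
    -- Zero capacity forces all other servers to send empty words.
    have huniv : U = u ⟨univ, univ_nonempty⟩ := by
      refine Finset.sum_eq_single_of_mem _ (mem_univ _) fun J _ hJ => ?_
      have h1 := hu J
      rw [centralCapacity, if_neg fun h => hJ (Subtype.ext h), div_le_iff₀ hr, zero_mul] at h1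
      exact_mod_cast le_antisymm h1 (Nat.cast_nonneg _)
    have h1 := hu ⟨univ, univ_nonempty⟩
    rw [centralCapacity, if_pos rfl, div_le_one hr] at h1
    rwa [huniv]
  have hach : ∀ s : ℕ, Achievable P' (centralCapacity n)
      fun i => r / (r + (s + T + 2) / 2 ^ s) * R i := by
    intro s
    have hden : 0 < r * 2 ^ s + (s + T + 2) := by positivity
    have hratio : r / (r + (s + T + 2) / 2 ^ s) = r * 2 ^ s / (r * 2 ^ s + (s + T + 2)) := by
      field_simp
    obtain ⟨κ, _, φ, hκ, hφ⟩ := exists_separating_power S hin hout c.out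
      (fun j x x' h hs => c.eq_of_out_eq j h hs) (card_words t).le (2 ^ s)
    have hκ' : Fintype.card κ ≤ 2 ^ (2 ^ s * U + (s + T + 2)) := by
      refine hκ.trans ?_
      rw [card_words, pow_add, ← pow_mul, mul_comm U]
      refine Nat.mul_le_mul_left _ ?_
      have h1 : T + 2 ≤ 2 ^ (T + 2) := Nat.lt_two_pow_self.le
      have h2 : 1 ≤ 2 ^ s := Nat.one_le_two_pow
      calc 2 ^ s * T + 2 ≤ 2 ^ s * (T + 2) := by nlinarith
        _ ≤ 2 ^ s * 2 ^ (T + 2) := Nat.mul_le_mul_left _ h1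
        _ = 2 ^ (s + T + 2) := by rw [← pow_add, add_assoc]
    refine ⟨fun i => mul_nonneg (by positivity) (h0 i), fun i => 2 ^ s * t i, _, _, hden,
      nonempty_code_of_card_le hκ' hn
        (fun x => φ fun l i a => x i (finProdFinEquiv (l, a))) ?_, ?_, ?_⟩
    · intro j x x' h hs
      have := hφ j _ _ h fun i hi l => by rw [hs i hi]
      funext a
      obtain ⟨⟨l, a⟩, rfl⟩ := finProdFinEquiv.surjective a
      exact congrFun (this l) a
    · intro i
      have hRi := (le_div_iff₀ hr).1 (ht i)
      change r / (r + (s + T + 2) / 2 ^ s) * R i ≤ ((2 ^ s * t i : ℕ) : ℝ) / _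
      rw [hratio, div_mul_eq_mul_div]
      push_cast
      refine div_le_div_of_nonneg_right ?_ hden.le
      nlinarith [pow_pos (two_pos : (0 : ℝ) < 2) s]
    · intro J
      unfold centralCapacity
      split_ifs
      · rw [div_le_one hden]
        push_cast
        nlinarith [pow_pos (two_pos : (0 : ℝ) < 2) s]
      · simp
  have hlim0 : Tendsto (fun s : ℕ => ((s : ℝ) + T + 2) / 2 ^ s) atTop (𝓝 0) := by
    have h1 := tendsto_self_mul_const_pow_of_abs_lt_one (r := (1 / 2 : ℝ))
      (by rw [abs_of_pos] <;> norm_num)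
    have h2 := (tendsto_pow_atTop_nhds_zero_of_lt_one (r := (1 / 2 : ℝ)) (by norm_num)
      (by norm_num)).const_mul ((T : ℝ) + 2)
    have h3 := h1.add h2
    rw [mul_zero, add_zero] at h3
    refine h3.congr fun s => ?_
    rw [one_div, inv_pow]
    ring
  refine mem_closure_of_tendsto (f := fun (s : ℕ) (i : Fin n) =>
    r / (r + ((s : ℝ) + T + 2) / 2 ^ s) * R i) (b := atTop) ?_ (Eventually.of_forall hach)
  refine tendsto_pi_nhds.2 fun i => ?_
  have h1 : Tendsto (fun s : ℕ => r / (r + ((s : ℝ) + T + 2) / 2 ^ s)) atTop (𝓝 1) := by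
    have := (tendsto_const_nhds (x := r)).div ((tendsto_const_nhds (x := r)).add hlim0)
      (by simpa using hr.ne')
    rwa [add_zero, div_self hr.ne'] at this
  simpa using h1.mul_const (R i)

theorem capacityRegion_removeEdge {n : ℕ} (P : Problem n) {i j : Fin n} (hij : P.graph.Adj i j)
    (hcyc : ¬ OnDirectedCycle P.graph i j) :
    capacityRegion (P.removeEdge i j) (centralCapacity n) =
      capacityRegion P (centralCapacity n) := by
  refine Set.Subset.antisymm (closure_mono fun R hR => hR.of_side_subset fun k => ?_)
    (closure_minimal (fun R hR => hR.mem_capacityRegion_of_closed i.pos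
      {v | Relation.ReflTransGen P.graph.Adj j v} ?_ ?_) isClosed_closure)
  · simp only [Problem.removeEdge]
    split_ifs
    · exact erase_subset _ _
    · exact Subset.rfl
  · intro k _ a ha haS
    simp only [Problem.removeEdge]
    split_ifs
    · refine mem_erase.2 ⟨?_, ha⟩
      rintro rfl
      exact hcyc (onDirectedCycle_of_reachable hij haS)
    · exact ha
  · intro k hk a ha
    refine ⟨fun haS => hk (Relation.ReflTransGen.tail haS ha), ?_⟩
    have hkj : k ≠ j := by
      rintro rfl
      exact hk Relation.ReflTransGen.refl
    simpa [Problem.removeEdge, hkj] using ha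

end IndexCoding

open IndexCoding in
theorem mainTheorem6 :
    -- the sum rates of the two distributed problems are 9 and 10
    IsGreatest (sumRates (capacityRegion problemA (unitCapacity 3))) 9 ∧
    IsGreatest (sumRates (capacityRegion problemB (unitCapacity 3))) 10 ∧
    capacityRegion problemA (unitCapacity 3) ≠ capacityRegion problemB (unitCapacity 3) ∧
    -- the first problem arises from the second by removing the edge 3 → 1, on no directed cycle
    problemB.graph.Adj 2 0 ∧
    ¬ OnDirectedCycle problemB.graph 2 0 ∧
    problemB.removeEdge 2 0 = problemA ∧
    -- in the centralized case, such a removal never changes the capacity region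
    (∀ (n : ℕ) (P : Problem n) (i j : Fin n), P.graph.Adj i j →
      ¬ OnDirectedCycle P.graph i j →
      capacityRegion (P.removeEdge i j) (centralCapacity n) =
        capacityRegion P (centralCapacity n)) := by
  refine ⟨isGreatest_sumRates_problemA, isGreatest_sumRates_problemB, fun h => ?_, ?_,
    not_onDirectedCycle_problemB, removeEdge_problemB,
    fun n P i j hij hcyc => capacityRegion_removeEdge P hij hcyc⟩
  · have h1 := isGreatest_sumRates_problemA
    rw [h] at h1
    have := h1.unique isGreatest_sumRates_problemB
    norm_num at this
  · change (2 : Fin 3) ∈ problemB.side 0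
    decide
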